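/- An instance of Capacitated Location Routing (CLR) consists of disjoint finite sets $F \neq \emptyset$ (facilities) and $C$ (clients), opening costs $f(w) \ge 0$ and capacities $u(w) \in \mathbb{Z}_{\ge 0}$ for $w \in F$, demands $d(v) \in \mathbb{Z}_{\ge 0}$ for $v \in C$, a vehicle capacity $\bar u \in \mathbb{Z}_{>0}$, and a symmetric distance function $c : V \times V \to \mathbb{R}_{\ge 0}$ on $V := F \cup C$ that vanishes on the diagonal and satisfies the triangle inequality (distinct points may be at distance $0$). A tour $T$ consists of a facility $w_T$, a nonempty sequence of clients $v^1, \dots, v^k$, and real service values $x_T(v) \ge 0$ ($v \in C$) with $x_T(v) = 0$ for $v \notin \{v^1, \dots, v^k\}$; its cost is $c(T) = c(w_T, v^1) + \sum_{i=1}^{k-1} c(v^i, v^{i+1}) + c(v^k, w_T)$. A solution is a pair $(F', \mathcal{T})$ of a set $F' \subseteq F$ and a finite family (repetitions allowed) $\mathcal{T}$ of tours; its cost is $\sum_{w \in F'} f(w) + \sum_{T \in \mathcal{T}} c(T)$. Let $L'$ be the minimum weight of a spanning tree in the graph on $V \cup \{r\}$ with edges $\{r, w\}$ ($w \in F$) of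 weight $0$, $\{v, w\}$ ($v \in C$, $w \in F$) of weight $c(v,w) + \frac12 f(w)$, and $\{v, v'\}$ ($v \ne v'$ in $C$) of weight $c(v, v')$. Let $\tilde L$ be the minimum of $\sum_{w \in \tilde F} \big( f(w) + \sum_{v \in C} \frac{2 c(v,w)}{\bar u} x(v,w) \big)$ over all $\tilde F \subseteq F$ and real $x(v,w) \ge 0$ ($v \in C$, $w \in \tilde F$) with $\sum_{w \in \tilde F} x(v,w) = d(v)$ for all $v \in C$ and $\sum_{v \in C} x(v,w) \le u(w)$ for all $w \in \tilde F$; that is, $\tilde L$ is the optimal value of Capacitated Facility Location with distances $2c/\bar u$. Corollary. Let $\varepsilon \in (0,1]$ and consider any CLR instance for which the facility location problem defining $\tilde L$ has a feasible solution. Then both minima $L'$ and $\tilde L$ are attained, and there is a solution $(F', \mathcal{T})$ such that 1. $w_T \in F'$ for every $T \in \mathcal{T}$; 2. $\sum_{T \in \mathcal{T}} x_T(v) = d(v)$ for every $v \in C$; 3. $\sum_{v \in C} x_T(v) \le \bar u$ for every $T \in \mathcal{T}$; 4. $\sum_{T \in \mathcal{T} : w_T = w} \sum_{v \in C} x_T(v)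 \le u(w) + \varepsilon \bar u$ for every $w \in F$; 5. $\sum_{w \in F'} f(w) + \sum_{T \in \mathcal{T}} c(T) \le 4 L' + \frac{2}{\varepsilon} \tilde L$. -/

import Mathlib

/-- An instance of Capacitated Facility Location with facilities `F` and clients `C`. The points are
the disjoint union `F ⊕ C`; distances form a metric in the usual sense of combinatorial
optimization, so distinct points may be at distance `0` (for example, a client located at a
facility). -/
structure CFLInstance (F C : Type*) where
  /-- opening costs -/
  openCost : F → ℝ
  openCost_nonneg : ∀ w, 0 ≤ openCost w
  /-- facility capacities -/
  capacity : F → ℕ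
  /-- client demands -/
  demand : C → ℕ
  /-- travel costs -/
  dist : F ⊕ C → F ⊕ C → ℝ
  dist_nonneg : ∀ p q, 0 ≤ dist p q
  dist_self : ∀ p, dist p p = 0
  dist_comm : ∀ p q, dist p q = dist q p
  dist_triangle : ∀ p q s, dist p s ≤ dist p q + dist q s

/-- An instance of Capacitated Location Routing: the input of Capacitated Facility Location together
with a positive integral vehicle capacity. -/
structure CLRInstance (F C : Type*) extends CFLInstance F C where
  vehicleCap : ℕ
  vehicleCap_pos : 0 < vehicleCap

namespace CFLInstance

variable {F C : Type*} [Fintype C]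

/-- `(F', x)` is a feasible CFL solution, where `x v w` is the demand of `v` served from `w`. The
values `x v w` with `w` not opened are irrelevant, and are normalized to `0`. -/
structure IsFeasible (I : CFLInstance F C) (F' : Finset F) (x : C → F → ℝ) : Prop where
  nonneg : ∀ v w, 0 ≤ x v w
  closed : ∀ v w, w ∉ F' → x v w = 0
  demand_eq : ∀ v, ∑ w ∈ F', x v w = I.demand v
  capacity_le : ∀ w, ∑ v, x v w ≤ I.capacity w

/-- The cost of a CFL solution. -/
def cost (I : CFLInstance F C) (F' : Finset F) (x : C → F → ℝ) : ℝ :=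
  ∑ w ∈ F', I.openCost w + ∑ v, ∑ w ∈ F', I.dist (.inr v) (.inl w) * x v w

/-- The set of costs of all feasible CFL solutions. -/
def feasibleCosts (I : CFLInstance F C) : Set ℝ :=
  {t | ∃ (F' : Finset F) (x : C → F → ℝ), I.IsFeasible F' x ∧ I.cost F' x = t}

end CFLInstance

/-- A tour: a facility, a (nonempty) sequence of clients, and service values that vanish outside
the sequence. -/
structure Tour (F C : Type*) where
  depot : F
  clients : List C
  clients_ne_nil : clients ≠ []
  service : C → ℝ
  service_nonneg : ∀ v, 0 ≤ service v
  service_eq_zero : ∀ v, v ∉ clients → service v = 0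

/-- The length of the walk through the points of a list, in order. -/
def walkLength {P : Type*} (c : P → P → ℝ) : List P → ℝ
  | p :: q :: l => c p q + walkLength c (q :: l)
  | _ => 0

/-- A candidate solution: the facilities to open and a finite collection of tours (which may contain
the same tour several times). -/
structure CLRSolution (F C : Type*) where
  opened : Finset F
  tours : Multiset (Tour F C)

namespace CLRInstance

variable {F C : Type*}

/-- The length of a tour: from its facility through its clients in order, and back. -/
def tourCost (I : CLRInstance F C) (T : Tour F C) : ℝ :=
  walkLength I.dist (.inl T.depot :: (T.clients.map .inr ++ [.inl T.depot]))

/-- Total opening cost plus total length of the tours. -/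
def solutionCost (I : CLRInstance F C) (S : CLRSolution F C) : ℝ :=
  ∑ w ∈ S.opened, I.openCost w + (S.tours.map I.tourCost).sum

/-- Each tour originates from an open facility. -/
def OpenFacilityConstraint (S : CLRSolution F C) : Prop :=
  ∀ T ∈ S.tours, T.depot ∈ S.opened

/-- The demand of every client is served exactly. -/
def DemandConstraint (I : CLRInstance F C) (S : CLRSolution F C) : Prop :=
  ∀ v, (S.tours.map fun T => T.service v).sum = I.demand v

/-- No tour serves more than the vehicle capacity. -/
def VehicleConstraint [Fintype C] (I : CLRInstance F C) (S : CLRSolution F C) : Prop :=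
  ∀ T ∈ S.tours, ∑ v, T.service v ≤ I.vehicleCap

open Classical in
/-- The total demand served from the facility `w`. -/
noncomputable def facilityLoad [Fintype C] (S : CLRSolution F C) (w : F) : ℝ :=
  ((S.tours.filter fun T => T.depot = w).map fun T => ∑ v, T.service v).sum

/-! The spanning tree bound. The vertices are the facilities, the clients and an extra root
`none`. -/

/-- Adjacency in the auxiliary graph: root to facility, client to facility, and client to a
different client. -/
def auxAdj : Option (F ⊕ C) → Option (F ⊕ C) → Prop
  | none, some (.inl _) => True
  | some (.inl _), none => True
  | some (.inl _), some (.inr _) => True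
  | some (.inr _), some (.inl _) => True
  | some (.inr v), some (.inr v') => v ≠ v'
  | _, _ => False

/-- The auxiliary graph. -/
def auxGraph (F C : Type*) : SimpleGraph (Option (F ⊕ C)) where
  Adj := auxAdj
  symm := ⟨by
    rintro (_ | _ | _) (_ | _ | _) h <;> simp_all [auxAdj, eq_comm]⟩
  loopless := ⟨by
    rintro (_ | _ | _) h <;> simp_all [auxAdj]⟩

/-- Edge weights of the auxiliary graph: `0` at the root, distance plus half of the opening cost
between a client and a facility, distance between two clients. (Pairs of facilities are not
edges.) -/
noncomputable def auxWeight (I : CLRInstance F C) : Option (F ⊕ C) → Option (F ⊕ C) → ℝ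
  | some (.inr v), some (.inl w) => I.dist (.inr v) (.inl w) + I.openCost w / 2
  | some (.inl w), some (.inr v) => I.dist (.inr v) (.inl w) + I.openCost w / 2
  | some (.inr v), some (.inr v') => I.dist (.inr v) (.inr v')
  | _, _ => 0

theorem auxWeight_comm (I : CLRInstance F C) (p q : Option (F ⊕ C)) :
    I.auxWeight p q = I.auxWeight q p := by
  rcases p with _ | _ | _ <;> rcases q with _ | _ | _ <;> simp [auxWeight, I.dist_comm]

open Classical in
/-- The total weight of a graph on the vertices of the auxiliary graph. -/
noncomputable def graphWeight [Fintype F] [Fintype C] (I : CLRInstance F C)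
    (T : SimpleGraph (Option (F ⊕ C))) : ℝ :=
  ∑ e ∈ T.edgeFinset, Sym2.lift ⟨I.auxWeight, I.auxWeight_comm⟩ e

/-- The set of weights of all spanning trees of the auxiliary graph. -/
def spanningTreeWeights [Fintype F] [Fintype C] (I : CLRInstance F C) : Set ℝ :=
  {t | ∃ T : SimpleGraph (Option (F ⊕ C)), T ≤ auxGraph F C ∧ T.IsTree ∧ I.graphWeight T = t}

/-- The spanning tree bound: the weight of a minimum spanning tree of the auxiliary graph. -/
noncomputable def mstBound [Fintype F] [Fintype C] (I : CLRInstance F C) : ℝ :=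
  sInf I.spanningTreeWeights

/-- The facility location instance of the second bound: same data, with distances multiplied by
`2 / vehicleCap`. -/
noncomputable def toScaledCFL (I : CLRInstance F C) : CFLInstance F C where
  openCost := I.openCost
  openCost_nonneg := I.openCost_nonneg
  capacity := I.capacity
  demand := I.demand
  dist p q := 2 * I.dist p q / I.vehicleCap
  dist_nonneg p q := by have := I.dist_nonneg p q; positivity
  dist_self p := by simp [I.dist_self]
  dist_comm p q := by rw [I.dist_comm]
  dist_triangle p q s := by
    rw [← add_div]
    have := I.dist_triangle p q s
    gcongr
    linarith

/-- The facility location bound: the optimal value of the scaled CFL instance. -/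
noncomputable def cflBound [Fintype C] (I : CLRInstance F C) : ℝ :=
  sInf I.toScaledCFL.feasibleCosts

end CLRInstance

/-! A minimum spanning tree provides walks through all clients, the facility location solution
provides room for most of the demand, and cutting the walks into pieces of service `s = ε *
vehicleCap / 2` links the two.

Tree side: orienting a minimum spanning tree towards its root gives each client a parent. Clients
are inserted next to their parents by increasing rank, each at twice the distance to the parent. The
halves `f(w) / 2` in the edge weights, doubled, pay for opening `w` when its first client arrives.
So every client lies on exactly one walk starting at a facility, and walks plus openings cost at
most `2 L'` (`exists_client_lists_le_mstBound`).

Cutting: `exists_cut` splits each walk, from its far end, into pieces of service exactly `s` and a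
remainder of service below `s` next to the facility. Remainders are served from their own facility.
The pieces are distributed as the optimal `x` distributes the demand, which is a fractional
assignment of unit jobs. Birkhoff's theorem rounds it at no extra cost, exceeding each capacity by
at most `s` (`IsFeasible.exists_piece_assignment`).

Rounding and remainder together exceed a capacity by at most `2 * s = ε * vehicleCap`. Closing the
walks into tours at most doubles them, giving `4 L'`. The detours from the pieces to their
facilities cost at most `2 / s` times the connection cost of `x`, which is `2 / ε` times its share
of the facility location bound. -/

/-! ### Walks -/

namespace CFLInstance

variable {F C : Type*}

/-- Inserting a point into a walk next to one of its points `q` costs at most twice the distance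
to `q`. -/
theorem exists_insert_walkLength_le (I : CFLInstance F C) (v : C) (q : F ⊕ C) (l : List C)
    (p : F ⊕ C) (hq : q ∈ p :: l.map Sum.inr) :
    ∃ l' : List C, l'.Perm (v :: l) ∧
      walkLength I.dist (p :: l'.map Sum.inr) ≤
        walkLength I.dist (p :: l.map Sum.inr) + 2 * I.dist (.inr v) q := by
  induction l generalizing p with
  | nil =>
    obtain rfl : q = p := by simpa using hq
    refine ⟨[v], List.Perm.refl _, ?_⟩
    have := I.dist_nonneg (.inr v) q
    have := I.dist_comm (.inr v) q
    simp only [List.map_cons, List.map_nil, walkLength]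
    linarith
  | cons a l ih =>
    by_cases hqp : q = p
    · subst hqp
      refine ⟨v :: a :: l, List.Perm.refl _, ?_⟩
      have := I.dist_triangle (.inr v) q (.inr a)
      have := I.dist_comm (.inr v) q
      simp only [List.map_cons, walkLength]
      linarith
    · obtain ⟨l', hl', hle⟩ := ih (.inr a) (by simpa [hqp] using hq)
      refine ⟨a :: l', (hl'.cons a).trans (List.Perm.swap _ _ _), ?_⟩
      simp only [List.map_cons, walkLength] at hle ⊢
      linarith

/-- Closing up a walk through an arbitrary extra point `z`. -/
theorem walkLength_append_singleton_add_le (I : CFLInstance F C) (z q : F ⊕ C)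
    (l : List (F ⊕ C)) (p : F ⊕ C) (hq : q ∈ p :: l) :
    walkLength I.dist (p :: (l ++ [z])) + I.dist p q ≤
      2 * walkLength I.dist (p :: l) + I.dist q z := by
  -- The walk from `p` to `q` has length at least `I.dist p q`, and the return to `z` may go back to
  -- `q` first. The two parts together use a second copy of the walk. The term `I.dist p q` is what
  -- allows the closed walk to be entered near any client.
  induction l generalizing p q with
  | nil =>
    obtain rfl : q = p := by simpa using hq
    simp [walkLength, I.dist_self]
  | cons a l ih =>
    rcases List.mem_cons.1 hq with rfl | hq
    · have := ih a a (by simp)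
      have := I.dist_triangle a q z
      have := I.dist_comm a q
      have := I.dist_self a
      have := I.dist_self q
      simp only [List.cons_append, walkLength]
      linarith
    · have := ih q a hq
      have := I.dist_triangle p a q
      simp only [List.cons_append, walkLength]
      linarith

/-- The closed walk from `z` through a nonempty sequence of clients costs at most twice the length
of the sequence, plus twice the distance to any of its clients. -/
theorem walkLength_closed_le (I : CFLInstance F C) (z : F ⊕ C) (l : List C) (v : C) (hv : v ∈ l) :
    walkLength I.dist (z :: (l.map .inr ++ [z])) ≤
      2 * walkLength I.dist (l.map .inr) + 2 * I.dist (.inr v) z := by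
  cases l with
  | nil => simp at hv
  | cons a l =>
    have h := I.walkLength_append_singleton_add_le z (.inr v) (l.map .inr) (.inr a)
      (by simpa using hv)
    have := I.dist_triangle z (.inr v) (.inr a)
    have := I.dist_comm z (.inr v)
    have := I.dist_comm (.inr v) (.inr a)
    simp only [List.map_cons, List.cons_append, walkLength]
    linarith

/-- The closed walk from `z` costs at most twice the open one. -/
theorem walkLength_closed_le_two_mul (I : CFLInstance F C) (z : F ⊕ C) (l : List (F ⊕ C)) :
    walkLength I.dist (z :: (l ++ [z])) ≤ 2 * walkLength I.dist (z :: l) := by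
  have := I.walkLength_append_singleton_add_le z z l z (by simp)
  linarith

end CFLInstance

/-! ### Cutting a sequence of clients into pieces of equal demand -/

/-- A sequence of clients with service values supported on it. -/
structure DemandPiece (C : Type*) where
  clients : List C
  service : C → ℝ
  service_nonneg : ∀ v, 0 ≤ service v
  service_eq_zero : ∀ v, v ∉ clients → service v = 0

namespace DemandPiece

variable {C : Type*}

/-- The piece consisting of an amount `a` of demand at `v`. -/
noncomputable def single [DecidableEq C] (v : C) (a : ℝ) (ha : 0 ≤ a) : DemandPiece C where
  clients := [v]
  service := Pi.single v a
  service_nonneg u := by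
    by_cases h : u = v
    · subst h; simpa
    · simp [h]
  service_eq_zero u hu := by simp_all

/-- Prepend the client `v`, and serve an amount `a` of its demand. -/
noncomputable def cons [DecidableEq C] (v : C) (a : ℝ) (ha : 0 ≤ a) (Q : DemandPiece C) :
    DemandPiece C where
  clients := v :: Q.clients
  service := Q.service + Pi.single v a
  service_nonneg u := by
    have := Q.service_nonneg u
    by_cases h : u = v
    · subst h; simp; linarith
    · simpa [h]
  service_eq_zero u hu := by
    simp only [List.mem_cons, not_or] at hu
    simp [hu.1, Q.service_eq_zero u hu.2]

end DemandPiece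

/-- A sequence of clients can be cut into pieces of service exactly `s` and an initial piece of
service less than `s`, without increasing the total length. -/
theorem CFLInstance.exists_cut {F C : Type*} [Fintype C] [DecidableEq C] (I : CFLInstance F C)
    {s : ℝ} (hs : 0 < s) (d : C → ℝ) (hd : ∀ v, 0 ≤ d v) (l : List C) :
    ∃ (Ps : List (DemandPiece C)) (R : DemandPiece C),
      (∀ Q ∈ Ps, ∑ v, Q.service v = s) ∧
      ∑ v, R.service v < s ∧ (R.clients ≠ [] → l ≠ []) ∧
      (∀ u, (Ps.map fun Q => Q.service u).sum + R.service u = l.count u * d u) ∧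
      ∀ p, (Ps.map fun Q => walkLength I.dist (Q.clients.map .inr)).sum +
        walkLength I.dist (p :: R.clients.map .inr) ≤ walkLength I.dist (p :: l.map .inr) := by
  -- The remainder is at the front of the sequence. The length bound holds for every starting point
  -- `p`, so the next client can take the role of `p`.
  induction l with
  | nil =>
    exact ⟨[], ⟨[], 0, by simp, by simp⟩, by simp, by simpa using hs, by simp, by simp, by simp⟩
  | cons v l ih =>
    obtain ⟨Ps, R, hPs, hR, -, hsum, hlen⟩ := ih
    have hcount (u : C) : (((v :: l).count u : ℕ) : ℝ) * d u =
        l.count u * d u + (Pi.single v (d v) : C → ℝ) u := by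
      by_cases h : u = v
      · subst h; simp; ring
      · simp [h, Ne.symm h]
    by_cases hlt : ∑ u, R.service u + d v < s
    · refine ⟨Ps, R.cons v (d v) (hd v), hPs, ?_, by simp, fun u => ?_, fun p => ?_⟩
      · simpa [DemandPiece.cons, Finset.sum_add_distrib] using hlt
      · rw [hcount, ← hsum u]
        simp [DemandPiece.cons, add_assoc]
      · have := hlen (.inr v)
        simp only [DemandPiece.cons, List.map_cons, walkLength]
        linarith
    · push Not at hlt
      -- The demand of `v` is split: `a` tops up the remainder to a full piece, `k` pieces consist
      -- of `v` alone and have length `0`, and the rest at `v` is the new remainder.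
      set a := s - ∑ u, R.service u with ha
      set k := ⌊(d v - a) / s⌋₊ with hk
      have ha0 : 0 ≤ a := by linarith
      have hda : 0 ≤ d v - a := by linarith
      have hk1 : k * s ≤ d v - a := by
        rw [← le_div_iff₀ hs]; exact Nat.floor_le (by positivity)
      have hk2 : d v - a < (k + 1) * s := by
        rw [← div_lt_iff₀ hs]; exact Nat.lt_floor_add_one _
      refine ⟨R.cons v a ha0 :: (List.replicate k (.single v s hs.le) ++ Ps),
        .single v (d v - a - k * s) (by linarith), ?_, ?_, by simp, fun u => ?_, fun p => ?_⟩
      · intro Q hQ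
        simp only [List.mem_cons, List.mem_append, List.mem_replicate] at hQ
        rcases hQ with rfl | ⟨-, rfl⟩ | hQ
        · simp [DemandPiece.cons, Finset.sum_add_distrib, ha]
        · simp [DemandPiece.single]
        · exact hPs Q hQ
      · simp only [DemandPiece.single, Finset.sum_pi_single', Finset.mem_univ, if_true]
        linarith
      · rw [hcount, ← hsum u]
        by_cases h : u = v
        · subst h
          simp [DemandPiece.cons, DemandPiece.single]
          ring
        · simp [DemandPiece.cons, DemandPiece.single, h]
          ring
      · have := hlen (.inr v)
        simp [DemandPiece.cons, DemandPiece.single, walkLength]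
        linarith

/-! ### Rounding a fractional assignment -/

/-- A fractional assignment of `J` to slots of unit capacity can be rounded to an injective
assignment of no larger cost. -/
theorem exists_injective_sum_le {J S : Type*} [Fintype J] [Fintype S] (z : J → S → ℝ)
    (hz : ∀ j t, 0 ≤ z j t) (hrow : ∀ j, ∑ t, z j t = 1) (hcol : ∀ t, ∑ j, z j t ≤ 1)
    (κ : J → S → ℝ) :
    ∃ g : J → S, Function.Injective g ∧ ∑ j, κ j (g j) ≤ ∑ j, ∑ t, κ j t * z j t := by
  classical
  have htot : ∑ t, ∑ j, z j t = Fintype.card J := by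
    rw [Finset.sum_comm]; simp [hrow]
  have hcard : Fintype.card J ≤ Fintype.card S := by
    have h : ∑ t, ∑ j, z j t ≤ ∑ _t : S, (1 : ℝ) := Finset.sum_le_sum fun t _ => hcol t
    rw [htot] at h
    simpa using h
  obtain ⟨m, hm⟩ := Nat.exists_eq_add_of_le hcard
  let n := J ⊕ Fin m
  have e : n ≃ S := Fintype.equivOfCardEq (by simp [n, hm])
  -- The `m` dummy rows share the slack of each column equally, which makes the matrix doubly
  -- stochastic.
  let y : n → S → ℝ := fun i t => Sum.elim (fun j => z j t) (fun _ => (1 - ∑ j, z j t) / m) i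
  have hslack : ∑ t, (1 - ∑ j, z j t) = m := by
    rw [Finset.sum_sub_distrib, htot]; simp [hm]
  have hycol (t : S) : ∑ i, y i t = 1 := by
    simp only [n, y, Fintype.sum_sum_type, Sum.elim_inl, Sum.elim_inr, Finset.sum_const,
      Finset.card_univ, Fintype.card_fin, nsmul_eq_mul]
    -- Without dummy rows the total slack is `0`, so every column is already full.
    rcases Nat.eq_zero_or_pos m with h0 | h0
    · rw [h0] at hslack
      have := (Finset.sum_eq_zero_iff_of_nonneg
        (fun t _ => sub_nonneg.2 (hcol t))).1 (by simpa using hslack) t (Finset.mem_univ t)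
      simp [h0]; linarith
    · field_simp; ring
  have hyrow (i : n) : ∑ t, y i t = 1 := by
    rcases i with j | i
    · exact hrow j
    · have : (m : ℝ) ≠ 0 := by exact_mod_cast (Fin.pos i).ne'
      simp only [y, Sum.elim_inr]
      rw [← Finset.sum_div, hslack, div_self this]
  let M : Matrix n n ℝ := fun i i' => y i (e i')
  have hM : M ∈ doublyStochastic ℝ n := by
    rw [mem_doublyStochastic_iff_sum]
    refine ⟨fun i i' => ?_, fun i => ?_, fun i' => hycol _⟩
    · rcases i with j | i
      · exact hz _ _
      · exact div_nonneg (sub_nonneg.2 (hcol _)) (Nat.cast_nonneg _)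
    · exact (Equiv.sum_comp e (y i)).trans (hyrow i)
  obtain ⟨w, hw0, hw1, hwM⟩ := exists_eq_sum_perm_of_mem_doublyStochastic hM
  let cst : Equiv.Perm n → ℝ := fun σ => ∑ j, κ j (e (σ (.inl j)))
  have key : ∑ σ, w σ * cst σ = ∑ j, ∑ t, κ j t * z j t := by
    have h1 (j : J) : ∑ t, κ j t * z j t = ∑ i', κ j (e i') * M (.inl j) i' :=
      (Equiv.sum_comp e fun t => κ j t * z j t).symm
    simp only [h1, ← hwM, cst, Finset.mul_sum, Matrix.sum_apply]
    rw [Finset.sum_comm]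
    refine Finset.sum_congr rfl fun j _ => ?_
    rw [Finset.sum_comm]
    refine Finset.sum_congr rfl fun σ _ => ?_
    simp [Equiv.Perm.permMatrix, PEquiv.toMatrix_apply, mul_comm (κ j _), ite_mul]
    symm
    refine (Finset.sum_eq_single (σ (.inl j)) (fun b _ hb => if_neg (Ne.symm hb))
      fun h => absurd (Finset.mem_univ _) h).trans (if_pos rfl)
  -- The fractional cost is a convex combination of permutation costs, so some permutation does not
  -- exceed it.
  obtain ⟨σ, hσ⟩ : ∃ σ, cst σ ≤ ∑ j, ∑ t, κ j t * z j t := by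
    by_contra! h
    rw [← key] at h
    have h2 : ∑ σ, w σ * (∑ τ, w τ * cst τ) < ∑ σ, w σ * cst σ := by
      obtain ⟨σ, hσ⟩ : ∃ σ, 0 < w σ := by
        by_contra! h
        have := Finset.sum_nonpos fun σ (_ : σ ∈ Finset.univ) => h σ
        linarith
      exact Finset.sum_lt_sum (fun τ _ => mul_le_mul_of_nonneg_left (h τ).le (hw0 τ))
        ⟨σ, Finset.mem_univ _, mul_lt_mul_of_pos_left (h σ) hσ⟩
    rw [← Finset.sum_mul, hw1] at h2
    linarith
  exact ⟨fun j => e (σ (.inl j)),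
    e.injective.comp (σ.injective.comp Sum.inl_injective), hσ⟩

/-- A fractional assignment of `J` to facilities, with at most `N w` units assigned to `w`, can be
rounded to an assignment of no larger cost that respects the bounds `N`. -/
theorem exists_assignment_sum_le {J F : Type*} [Fintype J] [Fintype F] [DecidableEq F]
    (z : J → F → ℝ) (hz : ∀ j w, 0 ≤ z j w) (hrow : ∀ j, ∑ w, z j w = 1) (N : F → ℕ)
    (hcol : ∀ w, ∑ j, z j w ≤ N w) (κ : J → F → ℝ) :
    ∃ g : J → F, (∀ w, (Finset.univ.filter fun j => g j = w).card ≤ N w) ∧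
      ∑ j, κ j (g j) ≤ ∑ j, ∑ w, κ j w * z j w := by
  classical
  -- Facility `w` becomes `N w` unit slots, each receiving an equal share of `z j w`. If `N w = 0`,
  -- the column bound forces `z j w = 0`.
  have hsum (j : J) (f : F → ℝ) :
      ∑ t : (Σ w, Fin (N w)), f t.1 * (z j t.1 / N t.1) = ∑ w, f w * z j w := by
    rw [Fintype.sum_sigma]
    refine Finset.sum_congr rfl fun w _ => ?_
    rcases Nat.eq_zero_or_pos (N w) with h | h
    · have h0 : z j w = 0 := le_antisymm
        ((Finset.single_le_sum (fun j _ => hz j w) (Finset.mem_univ j)).trans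
          ((hcol w).trans_eq (by simp [h]))) (hz j w)
      simp [h0]
    · simp only [Finset.sum_const, Finset.card_univ, Fintype.card_fin, nsmul_eq_mul]
      field_simp
  obtain ⟨g, hg, hle⟩ := exists_injective_sum_le (S := Σ w, Fin (N w))
    (fun j t => z j t.1 / N t.1) (fun j t => div_nonneg (hz _ _) (Nat.cast_nonneg _))
    (fun j => by simpa [hrow] using hsum j 1)
    (fun t => by
      rw [← Finset.sum_div]
      exact div_le_one_of_le₀ (hcol _) (Nat.cast_nonneg _))
    (fun j t => κ j t.1)
  refine ⟨fun j => (g j).1, fun w => ?_, hle.trans_eq (Finset.sum_congr rfl fun j _ => hsum j _)⟩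
  have hsub : (Finset.univ.filter fun j => (g j).1 = w).image g ⊆
      Finset.univ.image fun i : Fin (N w) => (⟨w, i⟩ : Σ w, Fin (N w)) := by
    intro t ht
    simp only [Finset.mem_image, Finset.mem_filter, Finset.mem_univ, true_and] at ht ⊢
    obtain ⟨j, rfl, rfl⟩ := ht
    exact ⟨(g j).2, rfl⟩
  calc (Finset.univ.filter fun j => (g j).1 = w).card
      = ((Finset.univ.filter fun j => (g j).1 = w).image g).card :=
        (Finset.card_image_of_injective _ hg).symm
    _ ≤ _ := Finset.card_le_card hsub
    _ ≤ _ := Finset.card_image_le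
    _ = N w := by simp

/-! ### The minima are attained -/

namespace CLRInstance

variable {F C : Type*}

theorem auxWeight_nonneg (I : CLRInstance F C) (p q : Option (F ⊕ C)) : 0 ≤ I.auxWeight p q := by
  rcases p with _ | w | v <;> rcases q with _ | w' | v' <;> simp only [auxWeight, le_refl]
  · have := I.dist_nonneg (.inr v') (.inl w)
    have := I.openCost_nonneg w
    linarith
  · have := I.dist_nonneg (.inr v) (.inl w')
    have := I.openCost_nonneg w'
    linarith
  · exact I.dist_nonneg _ _

theorem auxGraph_connected (F C : Type*) [Nonempty F] : (auxGraph F C).Connected := by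
  obtain ⟨w₀⟩ := ‹Nonempty F›
  have hfac (w : F) : (auxGraph F C).Adj none (some (.inl w)) := by simp [auxGraph, auxAdj]
  have hcli (v : C) : (auxGraph F C).Adj (some (.inl w₀)) (some (.inr v)) := by
    simp [auxGraph, auxAdj]
  have h (q : Option (F ⊕ C)) : (auxGraph F C).Reachable none q := by
    rcases q with _ | w | v
    · exact .refl _
    · exact (hfac w).reachable
    · exact (hfac w₀).reachable.trans (hcli v).reachable
  exact ⟨fun p q => (h p).symm.trans (h q)⟩

theorem isLeast_mstBound [Fintype F] [Nonempty F] [Fintype C] (I : CLRInstance F C) :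
    IsLeast I.spanningTreeWeights I.mstBound := by
  classical
  have hfin : I.spanningTreeWeights.Finite := by
    refine (Set.finite_range I.graphWeight).subset ?_
    rintro t ⟨T, -, -, rfl⟩
    exact ⟨T, rfl⟩
  obtain ⟨T, hT, hT'⟩ := (auxGraph_connected F C).exists_isTree_le
  exact hfin.isCompact.isLeast_sInf ⟨_, T, hT, hT', rfl⟩

/-- Following shortest paths to the root in a connected subgraph of the auxiliary graph, every
client is connected to a facility or to a client of smaller rank. -/
theorem exists_parent [Fintype F] [Fintype C] (I : CLRInstance F C)
    (T : SimpleGraph (Option (F ⊕ C))) (hle : T ≤ auxGraph F C) (hT : T.Connected) :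
    ∃ (parent : C → F ⊕ C) (rank : C → ℕ),
      (∀ v u, parent v = .inr u → rank u < rank v) ∧
      ∑ v, I.auxWeight (some (.inr v)) (some (parent v)) ≤ I.graphWeight T := by
  classical
  have hex (v : C) : ∃ q : F ⊕ C, T.Adj (some (.inr v)) (some q) ∧
      T.dist none (some q) < T.dist none (some (.inr v)) := by
    obtain ⟨W, hW⟩ := hT.exists_walk_length_eq_dist (some (.inr v)) none
    cases W with
    | @cons _ q _ h W =>
      rcases q with _ | q
      · exact (hle h : auxAdj _ _).elim
      · refine ⟨q, h, ?_⟩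
        rw [SimpleGraph.dist_comm, SimpleGraph.dist_comm (u := none), ← hW,
          SimpleGraph.Walk.length_cons]
        exact Nat.lt_succ_of_le (SimpleGraph.dist_le W)
  choose parent hadj hlt using hex
  refine ⟨parent, fun v => T.dist none (some (.inr v)), fun v u h => by simpa [h] using hlt v, ?_⟩
  -- Two clients using the same edge would be each other's parents, but the distance to the root
  -- strictly decreases towards the parent.
  have hinj : Function.Injective fun v => s((some (.inr v) : Option (F ⊕ C)), some (parent v)) := by
    intro v v' h
    rcases Sym2.eq_iff.1 h with ⟨h, -⟩ | ⟨h1, h2⟩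
    · simpa using h
    · have := hlt v
      have := hlt v'
      rw [← h1, ← h2] at *
      omega
  rw [graphWeight]
  calc ∑ v, I.auxWeight (some (.inr v)) (some (parent v))
      = ∑ e ∈ Finset.univ.image
          fun v => s((some (.inr v) : Option (F ⊕ C)), some (parent v)),
          Sym2.lift ⟨I.auxWeight, I.auxWeight_comm⟩ e := by
        rw [Finset.sum_image hinj.injOn]; rfl
    _ ≤ _ := by
        refine Finset.sum_le_sum_of_subset_of_nonneg ?_ fun e _ _ => ?_
        · intro e he
          obtain ⟨v, -, rfl⟩ := Finset.mem_image.1 he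
          simpa using hadj v
        · induction e with
          | _ p q => exact I.auxWeight_nonneg p q

end CLRInstance

namespace CFLInstance

variable {F C : Type*}

/-- For each of the finitely many sets of open facilities, the feasible assignments form a closed
subset of a box (each value is at most the capacity), and the cost is continuous. -/
theorem isCompact_feasibleCosts [Finite F] [Fintype C] (I : CFLInstance F C) :
    IsCompact I.feasibleCosts := by
  have hrw : I.feasibleCosts = ⋃ F' : Finset F, I.cost F' '' {x | I.IsFeasible F' x} := by
    ext t; simp [feasibleCosts]
  rw [hrw]
  refine isCompact_iUnion fun F' => IsCompact.image ?_ ?_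
  · have hset : {x | I.IsFeasible F' x} =
        (⋂ v, ⋂ w, {x : C → F → ℝ | 0 ≤ x v w}) ∩
        ((⋂ v, ⋂ w, ⋂ (_ : w ∉ F'), {x : C → F → ℝ | x v w = 0}) ∩
        ((⋂ v, {x : C → F → ℝ | ∑ w ∈ F', x v w = I.demand v}) ∩
        ⋂ w, {x : C → F → ℝ | ∑ v, x v w ≤ I.capacity w})) := by
      ext x
      simp only [Set.mem_ofPred_eq, Set.mem_inter_iff, Set.mem_iInter]
      exact ⟨fun h => ⟨h.1, h.2, h.3, h.4⟩, fun h => ⟨h.1, h.2.1, h.2.2.1, h.2.2.2⟩⟩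
    have hclosed : IsClosed {x | I.IsFeasible F' x} := by
      rw [hset]
      refine .inter (isClosed_iInter fun v => isClosed_iInter fun w => ?_)
        (.inter (isClosed_iInter fun v => isClosed_iInter fun w => isClosed_iInter fun _ => ?_)
        (.inter (isClosed_iInter fun v => ?_) (isClosed_iInter fun w => ?_)))
      · exact isClosed_le (by fun_prop) (by fun_prop)
      · exact isClosed_eq (by fun_prop) (by fun_prop)
      · exact isClosed_eq (by fun_prop) (by fun_prop)
      · exact isClosed_le (by fun_prop) (by fun_prop)
    refine (isCompact_univ_pi fun _ : C => isCompact_univ_pi fun w : F =>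
      isCompact_Icc (a := (0 : ℝ)) (b := I.capacity w)).of_isClosed_subset hclosed ?_
    intro x hx v _ w _
    exact ⟨hx.nonneg v w, (Finset.single_le_sum (fun v _ => hx.nonneg v w)
      (Finset.mem_univ v)).trans (hx.capacity_le w)⟩
  · unfold cost
    fun_prop

end CFLInstance

/-! ### Distributing the clients to facilities along a tree -/

namespace CLRInstance

variable {F C : Type*}

/-- Clients can be arranged in sequences assigned to the facilities, of total cost at most twice
the total cost of connecting each client to its parent. -/
theorem exists_client_lists [Fintype F] [Fintype C] [DecidableEq C] (I : CLRInstance F C)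
    (parent : C → F ⊕ C) (rank : C → ℕ) (hrank : ∀ v u, parent v = .inr u → rank u < rank v) :
    ∃ l : F → List C, (∀ v, ∑ w, (l w).count v = 1) ∧
      ∑ w, ((if l w = [] then 0 else I.openCost w) +
        walkLength I.dist (.inl w :: (l w).map .inr)) ≤
        2 * ∑ v, I.auxWeight (some (.inr v)) (some (parent v)) := by
  classical
  -- Induction over parent-closed sets, adding a client of maximal rank last: a parent is always
  -- placed before its children.
  suffices H : ∀ A : Finset C, (∀ v ∈ A, ∀ u, parent v = .inr u → u ∈ A) →
      ∃ l : F → List C, (∀ v, ∑ w, (l w).count v = if v ∈ A then 1 else 0) ∧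
      ∑ w, ((if l w = [] then 0 else I.openCost w) +
        walkLength I.dist (.inl w :: (l w).map .inr)) ≤
        2 * ∑ v ∈ A, I.auxWeight (some (.inr v)) (some (parent v)) by
    simpa using H Finset.univ (by simp)
  intro A
  induction A using Finset.induction_on_max_value rank with
  | empty => exact fun _ => ⟨fun _ => [], by simp [walkLength]⟩
  | insert a A ha hmax ih =>
    intro hdown
    obtain ⟨l, hcount, hle⟩ := ih fun v hv u hu => by
      have h1 := hdown v (Finset.mem_insert_of_mem hv) u hu
      refine (Finset.mem_insert.1 h1).resolve_left ?_
      rintro rfl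
      exact absurd (hrank v u hu) (not_lt.2 (hmax v hv))
    obtain ⟨w, hw⟩ : ∃ w, parent a ∈ Sum.inl w :: (l w).map Sum.inr := by
      rcases hp : parent a with w | u
      · exact ⟨w, by simp⟩
      · have hu : u ∈ A := (Finset.mem_insert.1 (hdown a (by simp) u hp)).resolve_left (by
          rintro rfl
          exact lt_irrefl _ (hrank u u hp))
        have h1 := hcount u
        rw [if_pos hu] at h1
        obtain ⟨w, -, hw⟩ := Finset.exists_ne_zero_of_sum_ne_zero (h1.trans_ne one_ne_zero)
        exact ⟨w, by simpa using List.count_pos_iff.1 (Nat.pos_of_ne_zero hw)⟩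
    obtain ⟨l', hperm, hl'⟩ := I.exists_insert_walkLength_le a (parent a) (l w) (.inl w) hw
    have hne : l' ≠ [] := by rintro rfl; simpa using hperm.length_eq
    refine ⟨Function.update l w l', fun v => ?_, ?_⟩
    · have h1 (w' : F) : (Function.update l w l' w').count v =
          (l w').count v + if w' = w then (if v = a then 1 else 0) else 0 := by
        by_cases h : w' = w
        · subst h
          simp only [Function.update_self, hperm.count_eq, List.count_cons, beq_iff_eq, if_true,
            eq_comm (a := a)]
        · simp [h]
      simp only [h1, Finset.sum_add_distrib, hcount, Finset.sum_ite_eq', Finset.mem_univ, if_true,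
        Finset.mem_insert]
      by_cases hv : v = a
      · subst hv; simp [ha]
      · simp [hv]
    · rw [Finset.sum_insert ha, mul_add]
      set t := I.auxWeight (some (.inr a)) (some (parent a)) with ht
      have h1 (w' : F) : (if Function.update l w l' w' = [] then 0 else I.openCost w') +
          walkLength I.dist (.inl w' :: (Function.update l w l' w').map .inr) ≤
          ((if l w' = [] then 0 else I.openCost w') +
            walkLength I.dist (.inl w' :: (l w').map .inr)) + if w' = w then 2 * t else 0 := by
        by_cases h : w' = w
        · subst h
          simp only [Function.update_self, hne, if_false, if_true]
          -- If the parent is a facility, `2 * t` covers the insertion and the opening. If it is a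
          -- client, the list is nonempty and the opening is already paid.
          rcases hp : parent a with w₁ | u
          · obtain rfl : w₁ = w' := by simpa [hp] using hw
            have : t = I.dist (.inr a) (.inl w₁) + I.openCost w₁ / 2 := by rw [ht, hp]; rfl
            have := I.openCost_nonneg w₁
            rw [hp] at hl'
            split_ifs <;> linarith
          · have h2 : l w' ≠ [] := by
              rintro h0
              simp [h0, hp] at hw
            have : t = I.dist (.inr a) (.inr u) := by rw [ht, hp]; rfl
            rw [hp] at hl'
            simp only [h2, if_false]
            linarith
        · simp [h]
      refine (Finset.sum_le_sum fun w' _ => h1 w').trans ?_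
      rw [Finset.sum_add_distrib, Finset.sum_ite_eq']
      simp only [Finset.mem_univ, if_true]
      linarith

/-- Sequences of clients for the facilities, of total cost at most twice the spanning tree
bound. -/
theorem exists_client_lists_le_mstBound [Fintype F] [Nonempty F] [Fintype C] [DecidableEq C]
    (I : CLRInstance F C) :
    ∃ l : F → List C, (∀ v, ∑ w, (l w).count v = 1) ∧
      ∑ w, ((if l w = [] then 0 else I.openCost w) +
        walkLength I.dist (.inl w :: (l w).map .inr)) ≤ 2 * I.mstBound := by
  obtain ⟨T, hle, hT, hw⟩ := I.isLeast_mstBound.1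
  obtain ⟨parent, rank, hrank, hsum⟩ := I.exists_parent T hle hT.connected
  obtain ⟨l, hl, hcost⟩ := I.exists_client_lists parent rank hrank
  exact ⟨l, hl, hcost.trans (by linarith)⟩

end CLRInstance

/-! ### Assigning pieces of demand to facilities -/

/-- Pieces of equal service `s` can be assigned to the facilities of a facility location solution,
exceeding capacities by at most `s`, with total distance at most `1 / s` times the connection
cost. -/
theorem CFLInstance.IsFeasible.exists_piece_assignment {F C J : Type*} [Fintype F] [Fintype C]
    [Fintype J] [DecidableEq F] {I : CFLInstance F C} {F' : Finset F} {x : C → F → ℝ}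
    (hx : I.IsFeasible F' x) {s : ℝ} (hs : 0 < s) (Q : J → DemandPiece C)
    (hQ : ∀ j, ∑ v, (Q j).service v = s) (hdem : ∀ v, ∑ j, (Q j).service v ≤ I.demand v) :
    ∃ (g : J → F) (near : J → C), (∀ j, g j ∈ F') ∧ (∀ j, near j ∈ (Q j).clients) ∧
      (∀ w, (Finset.univ.filter fun j => g j = w).card * s ≤ I.capacity w + s) ∧
      s * ∑ j, I.dist (.inr (near j)) (.inl (g j)) ≤
        ∑ v, ∑ w ∈ F', I.dist (.inr v) (.inl w) * x v w := by
  classical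
  have hnear (j : J) (w : F) : ∃ u ∈ (Q j).clients, ∀ v ∈ (Q j).clients,
      I.dist (.inr u) (.inl w) ≤ I.dist (.inr v) (.inl w) := by
    have hne : (Q j).clients.toFinset.Nonempty := by
      rw [List.toFinset_nonempty_iff]
      intro h
      have := hQ j
      rw [Finset.sum_eq_zero fun v _ => (Q j).service_eq_zero v (by simp [h])] at this
      exact hs.ne this
    simpa using (Q j).clients.toFinset.exists_min_image (fun u => I.dist (.inr u) (.inl w)) hne
  choose near hmem hmin using hnear
  have hserv (j : J) (v : C) := (Q j).service_nonneg v
  have hdiv (v : C) (w : F) : 0 ≤ x v w / I.demand v :=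
    div_nonneg (hx.nonneg v w) (Nat.cast_nonneg _)
  have hle (v : C) (w : F) : (∑ j, (Q j).service v) * (x v w / I.demand v) ≤ x v w := by
    refine (mul_le_mul_of_nonneg_right (hdem v) (hdiv v w)).trans ?_
    rcases eq_or_ne (I.demand v : ℝ) 0 with h | h
    · simpa [h] using hx.nonneg v w
    · rw [mul_div_cancel₀ _ h]
  have hrow_x (v : C) : ∑ w, x v w = I.demand v := by
    rw [← hx.demand_eq v]
    exact (Finset.sum_subset (Finset.subset_univ _) fun w _ hw => hx.closed v w hw).symm
  -- Each client's share of a piece is split among facilities in the proportions given by `x`.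
  -- Clients without demand have no service, so division by zero is harmless.
  let z : J → F → ℝ := fun j w => ∑ v, (Q j).service v / s * (x v w / I.demand v)
  have hz (j : J) (w : F) : 0 ≤ z j w :=
    Finset.sum_nonneg fun v _ => mul_nonneg (div_nonneg (hserv j v) hs.le) (hdiv v w)
  have hrow (j : J) : ∑ w, z j w = 1 := by
    have h1 (v : C) : ∑ w, (Q j).service v / s * (x v w / I.demand v) = (Q j).service v / s := by
      rw [← Finset.mul_sum, ← Finset.sum_div, hrow_x]
      rcases eq_or_ne (I.demand v : ℝ) 0 with h | h
      · have h2 : (Q j).service v ≤ 0 :=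
          (Finset.single_le_sum (fun j _ => hserv j v) (Finset.mem_univ j)).trans
            ((hdem v).trans_eq h)
        rw [le_antisymm h2 (hserv j v)]
        simp
      · rw [div_self h, mul_one]
    rw [Finset.sum_comm]
    simp only [h1]
    rw [← Finset.sum_div, hQ, div_self hs.ne']
  -- Rounding up costs at most one extra piece, hence the excess `s`; the value `0` keeps pieces
  -- away from closed facilities.
  let N : F → ℕ := fun w => if w ∈ F' then ⌈I.capacity w / s⌉₊ else 0
  have hcol (w : F) : ∑ j, z j w ≤ N w := by
    by_cases hw : w ∈ F'
    · simp only [N, hw, if_true]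
      refine le_trans ?_ (Nat.le_ceil _)
      rw [le_div_iff₀ hs]
      calc (∑ j, z j w) * s
          = ∑ v, (∑ j, (Q j).service v) * (x v w / I.demand v) := by
            simp only [z]
            rw [Finset.sum_comm, Finset.sum_mul]
            refine Finset.sum_congr rfl fun v _ => ?_
            rw [Finset.sum_mul, Finset.sum_mul]
            refine Finset.sum_congr rfl fun j _ => ?_
            field_simp
        _ ≤ ∑ v, x v w := Finset.sum_le_sum fun v _ => hle v w
        _ ≤ I.capacity w := hx.capacity_le w
    · simp [N, hw, z, hx.closed _ w hw]
  obtain ⟨g, hg, hcost⟩ := exists_assignment_sum_le z hz hrow N hcol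
    fun j w => I.dist (.inr (near j w)) (.inl w)
  refine ⟨g, fun j => near j (g j), fun j => ?_, fun j => hmem _ _, fun w => ?_, ?_⟩
  · by_contra hj
    have h1 := hg (g j)
    simp only [N, hj, if_false, Nat.le_zero, Finset.card_eq_zero] at h1
    exact Finset.notMem_empty j (h1 ▸ by simp)
  · have h1 : ((Finset.univ.filter fun j => g j = w).card : ℝ) ≤ N w := by exact_mod_cast hg w
    have h2 : (N w : ℝ) ≤ I.capacity w / s + 1 := by
      have h0 : (0 : ℝ) ≤ I.capacity w / s := by positivity
      by_cases hw : w ∈ F'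
      · simp only [N, hw, if_true]
        exact (Nat.ceil_lt_add_one h0).le
      · simp only [N, hw, if_false, Nat.cast_zero]
        linarith
    calc _ ≤ (I.capacity w / s + 1) * s := mul_le_mul_of_nonneg_right (h1.trans h2) hs.le
      _ = I.capacity w + s := by field_simp
  · calc s * ∑ j, I.dist (.inr (near j (g j))) (.inl (g j))
        ≤ s * ∑ j, ∑ w, I.dist (.inr (near j w)) (.inl w) * z j w :=
          mul_le_mul_of_nonneg_left hcost hs.le
      -- The distance from the nearest client of a piece is at most the weighted average over its
      -- clients.
      _ ≤ s * ∑ j, ∑ w, ∑ v, I.dist (.inr v) (.inl w) *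
            ((Q j).service v / s * (x v w / I.demand v)) := by
          refine mul_le_mul_of_nonneg_left (Finset.sum_le_sum fun j _ =>
            Finset.sum_le_sum fun w _ => ?_) hs.le
          rw [Finset.mul_sum]
          refine Finset.sum_le_sum fun v _ => ?_
          by_cases hv : v ∈ (Q j).clients
          · exact mul_le_mul_of_nonneg_right (hmin j w v hv)
              (mul_nonneg (div_nonneg (hserv j v) hs.le) (hdiv v w))
          · simp [(Q j).service_eq_zero v hv]
      _ = ∑ v, ∑ w, I.dist (.inr v) (.inl w) *
            ((∑ j, (Q j).service v) * (x v w / I.demand v)) := by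
          have h1 : ∀ j, ∑ w, ∑ v, I.dist (.inr v) (.inl w) *
              ((Q j).service v / s * (x v w / I.demand v)) = ∑ v, ∑ w, I.dist (.inr v) (.inl w) *
              ((Q j).service v / s * (x v w / I.demand v)) := fun j => Finset.sum_comm
          simp only [h1]
          rw [Finset.sum_comm, Finset.mul_sum]
          refine Finset.sum_congr rfl fun v _ => ?_
          rw [Finset.sum_comm, Finset.mul_sum]
          refine Finset.sum_congr rfl fun w _ => ?_
          rw [Finset.sum_mul, Finset.mul_sum, Finset.mul_sum]
          refine Finset.sum_congr rfl fun j _ => ?_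
          field_simp
      _ ≤ ∑ v, ∑ w, I.dist (.inr v) (.inl w) * x v w :=
          Finset.sum_le_sum fun v _ => Finset.sum_le_sum fun w _ =>
            mul_le_mul_of_nonneg_left (hle v w) (I.dist_nonneg _ _)
      _ = _ := Finset.sum_congr rfl fun v _ =>
          (Finset.sum_subset (Finset.subset_univ _) fun w _ hw => by simp [hx.closed v w hw]).symm

/-! ### The solution -/

namespace DemandPiece

variable {F C : Type*}

/-- The tour from `w` serving a piece of demand. -/
def toTour (Q : DemandPiece C) (w : F) (h : Q.clients ≠ []) : Tour F C where
  depot := w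
  clients := Q.clients
  clients_ne_nil := h
  service := Q.service
  service_nonneg := Q.service_nonneg
  service_eq_zero := Q.service_eq_zero

end DemandPiece

theorem CLRInstance.facilityLoad_eq_sum {F C : Type*} [Fintype C] [DecidableEq F]
    (S : CLRSolution F C) (w : F) :
    CLRInstance.facilityLoad S w =
      (S.tours.map fun T => if T.depot = w then ∑ v, T.service v else 0).sum := by
  unfold CLRInstance.facilityLoad
  induction S.tours using Multiset.induction_on with
  | empty => simp
  | cons T M ih =>
    by_cases h : T.depot = w
    · simp [h, ← ih]
    · simp [h, ← ih]

/-- A function vanishing outside `p` has the same sum over the subtype. -/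
theorem Fintype.sum_subtype_eq_sum {ι : Type*} [Fintype ι] (p : ι → Prop) [DecidablePred p]
    (f : ι → ℝ) (hf : ∀ i, ¬ p i → f i = 0) : ∑ i : {i // p i}, f i = ∑ i, f i := by
  rw [← Finset.sum_subtype (Finset.univ.filter p) (by simp) f, Finset.sum_filter]
  refine Finset.sum_congr rfl fun i _ => ?_
  split_ifs with h
  · rfl
  · exact (hf i h).symm

theorem Fintype.sum_sigma_getElem {ι α : Type*} [Fintype ι] (l : ι → List α) (f : α → ℝ) :
    ∑ j : (Σ i, Fin (l i).length), f (l j.1)[j.2] = ∑ i, ((l i).map f).sum := by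
  rw [Fintype.sum_sigma]
  exact Finset.sum_congr rfl fun i _ => Fin.sum_univ_fun_getElem (l i) f

theorem mainTheorem2 {F C : Type*} [Fintype F] [Nonempty F] [Fintype C]
    (I : CLRInstance F C)
    (hfeas : ∃ (F₀ : Finset F) (x₀ : C → F → ℝ), I.toScaledCFL.IsFeasible F₀ x₀)
    (ε : ℝ) (hε : 0 < ε) (hε1 : ε ≤ 1) :
    IsLeast I.spanningTreeWeights I.mstBound ∧
    IsLeast I.toScaledCFL.feasibleCosts I.cflBound ∧
    ∃ S : CLRSolution F C,
      CLRInstance.OpenFacilityConstraint S ∧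
      I.DemandConstraint S ∧
      I.VehicleConstraint S ∧
      (∀ w : F, CLRInstance.facilityLoad S w ≤ I.capacity w + ε * I.vehicleCap) ∧
      I.solutionCost S ≤ 4 * I.mstBound + 2 / ε * I.cflBound := by
  classical
  have hcfl : IsLeast I.toScaledCFL.feasibleCosts I.cflBound := by
    obtain ⟨F₀, x₀, h₀⟩ := hfeas
    exact I.toScaledCFL.isCompact_feasibleCosts.isLeast_sInf ⟨_, F₀, x₀, h₀, rfl⟩
  refine ⟨I.isLeast_mstBound, hcfl, ?_⟩
  obtain ⟨F', x, hx', hcost⟩ := hcfl.1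
  -- Feasibility does not involve distances, so it passes to the unscaled instance.
  have hx : I.toCFLInstance.IsFeasible F' x := ⟨hx'.1, hx'.2, hx'.3, hx'.4⟩
  have hcap : (0 : ℝ) < I.vehicleCap := by exact_mod_cast I.vehicleCap_pos
  -- A facility can be overloaded by `s` from the rounding and by less than `s` from its remainder;
  -- hence the factor one half.
  set s : ℝ := ε * I.vehicleCap / 2 with hs_def
  have hs : 0 < s := by positivity
  have hscap : s ≤ I.vehicleCap := by
    have := mul_le_mul_of_nonneg_right hε1 hcap.le
    rw [hs_def]; linarith
  obtain ⟨l, hl, hlcost⟩ := I.exists_client_lists_le_mstBound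
  have hcut (w : F) := I.exists_cut hs (fun v => (I.demand v : ℝ)) (fun v => Nat.cast_nonneg _) (l w)
  choose Ps R hPs hR hRne hdem hlen using hcut
  let Q : (Σ w, Fin (Ps w).length) → DemandPiece C := fun j => (Ps j.1)[j.2]
  have hsumQ (f : DemandPiece C → ℝ) : ∑ j, f (Q j) = ∑ w, ((Ps w).map f).sum :=
    Fintype.sum_sigma_getElem Ps f
  have hQ (j) : ∑ v, (Q j).service v = s := hPs _ _ (List.getElem_mem _)
  have htotal (v : C) : ∑ j, (Q j).service v + ∑ w, (R w).service v = I.demand v := by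
    rw [hsumQ fun P => P.service v, ← Finset.sum_add_distrib]
    simp only [hdem]
    rw [← Finset.sum_mul, ← Nat.cast_sum, hl, Nat.cast_one, one_mul]
  obtain ⟨g, near, hgF, hnear, hload, hconn⟩ := hx.exists_piece_assignment hs Q hQ fun v => by
    have := Finset.sum_nonneg fun w (_ : w ∈ Finset.univ) => (R w).service_nonneg v
    have := htotal v
    linarith
  have hRzero (w : F) (h : ¬ (R w).clients ≠ []) (v : C) : (R w).service v = 0 :=
    (R w).service_eq_zero v (by simp [not_not.1 h])
  let T₁ : (Σ w, Fin (Ps w).length) → Tour F C := fun j =>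
    (Q j).toTour (g j) (List.ne_nil_of_mem (hnear j))
  let T₂ : {w // (R w).clients ≠ []} → Tour F C := fun w => (R w).toTour w.1 w.2
  let S : CLRSolution F C :=
    { opened := F' ∪ Finset.univ.filter fun w => l w ≠ []
      tours := Finset.univ.val.map T₁ + Finset.univ.val.map T₂ }
  have hmem (T : Tour F C) (hT : T ∈ S.tours) : (∃ j, T₁ j = T) ∨ ∃ w, T₂ w = T := by
    simpa only [S, Multiset.mem_add, Multiset.mem_map, Finset.mem_val, Finset.mem_univ,
      true_and] using hT
  have hsum (f : Tour F C → ℝ) : (S.tours.map f).sum = ∑ j, f (T₁ j) + ∑ w, f (T₂ w) := by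
    simp only [S, Multiset.map_add, Multiset.sum_add, Multiset.map_map]
    rfl
  refine ⟨S, fun T hT => ?_, fun v => ?_, fun T hT => ?_, fun w => ?_, ?_⟩
  · rcases hmem T hT with ⟨j, rfl⟩ | ⟨w, rfl⟩
    · exact Finset.mem_union_left _ (hgF j)
    · exact Finset.mem_union_right _ (Finset.mem_filter.2 ⟨Finset.mem_univ w.1, hRne _ w.2⟩)
  · rw [hsum, ← htotal v]
    congr 1
    exact Fintype.sum_subtype_eq_sum (fun w => (R w).clients ≠ []) (fun w => (R w).service v)
      fun w hw => hRzero w hw v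
  · rcases hmem T hT with ⟨j, rfl⟩ | ⟨w, rfl⟩
    · exact (hQ j).trans_le hscap
    · exact (hR w).le.trans hscap
  · rw [CLRInstance.facilityLoad_eq_sum, hsum]
    have h1 : ∑ j, (if (T₁ j).depot = w then ∑ v, (T₁ j).service v else 0) =
        (Finset.univ.filter fun j => g j = w).card * s := by
      rw [← nsmul_eq_mul, ← Finset.sum_const, Finset.sum_filter]
      refine Finset.sum_congr rfl fun j _ => ?_
      exact if_congr Iff.rfl (hQ j) rfl
    have h2 : ∑ w', (if (T₂ w').depot = w then ∑ v, (T₂ w').service v else 0) =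
        ∑ v, (R w).service v := by
      refine (Fintype.sum_subtype_eq_sum (fun w => (R w).clients ≠ [])
        (fun w' => if w' = w then ∑ v, (R w').service v else 0) fun w' hw' => ?_).trans ?_
      · simp [hRzero w' hw']
      · simp
    rw [h1, h2]
    have := hload w
    have := hR w
    linarith
  · have hopen : ∑ w ∈ S.opened, I.openCost w ≤
        ∑ w ∈ F', I.openCost w + ∑ w, if l w = [] then 0 else I.openCost w := by
      have h1 : ∑ w, (if l w = [] then 0 else I.openCost w) =
          ∑ w ∈ Finset.univ.filter (fun w => l w ≠ []), I.openCost w := by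
        rw [Finset.sum_filter]
        exact Finset.sum_congr rfl fun w _ => by by_cases h : l w = [] <;> simp [h]
      rw [h1, ← Finset.sum_union_inter]
      exact le_add_of_nonneg_right (Finset.sum_nonneg fun w _ => I.openCost_nonneg w)
    have htour₁ (j) : I.tourCost (T₁ j) ≤ 2 * walkLength I.dist ((Q j).clients.map .inr) +
        2 * I.dist (.inr (near j)) (.inl (g j)) :=
      I.walkLength_closed_le _ _ _ (hnear j)
    have htour₂ : ∑ w, I.tourCost (T₂ w) ≤
        ∑ w, 2 * walkLength I.dist (.inl w :: (R w).clients.map .inr) := by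
      refine (Finset.sum_le_sum (g := fun w : {w // (R w).clients ≠ []} =>
        2 * walkLength I.dist (.inl w.1 :: (R w).clients.map .inr)) fun w _ =>
        I.walkLength_closed_le_two_mul _ _).trans_eq ?_
      refine Fintype.sum_subtype_eq_sum (fun w => (R w).clients ≠ [])
        (fun w => 2 * walkLength I.dist (.inl w :: (R w).clients.map .inr)) fun w hw => ?_
      simp [not_not.1 hw, walkLength]
    have hwalk : ∑ j, walkLength I.dist ((Q j).clients.map .inr) +
        ∑ w, walkLength I.dist (.inl w :: (R w).clients.map .inr) ≤
        ∑ w, walkLength I.dist (.inl w :: (l w).map .inr) := by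
      rw [hsumQ fun P => walkLength I.dist (P.clients.map .inr), ← Finset.sum_add_distrib]
      exact Finset.sum_le_sum fun w _ => hlen w (.inl w)
    have htours₁ := Finset.sum_le_sum fun j (_ : j ∈ Finset.univ) => htour₁ j
    rw [Finset.sum_add_distrib, ← Finset.mul_sum, ← Finset.mul_sum] at htours₁
    rw [← Finset.mul_sum] at htour₂
    rw [Finset.sum_add_distrib] at hlcost
    -- Only the walks are doubled, but the bound `2 L'` on walks plus openings is doubled as a
    -- whole, which uses that the openings are nonnegative.
    have hclosed : 0 ≤ ∑ w, if l w = [] then 0 else I.openCost w :=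
      Finset.sum_nonneg fun w _ => by
        split_ifs
        · exact le_rfl
        · exact I.openCost_nonneg w
    have hcflcost : ∑ w ∈ F', I.openCost w + 2 * ∑ j, I.dist (.inr (near j)) (.inl (g j)) ≤
        2 / ε * I.cflBound := by
      have h1 : I.toScaledCFL.cost F' x = ∑ w ∈ F', I.openCost w +
          2 / I.vehicleCap * ∑ v, ∑ w ∈ F', I.dist (.inr v) (.inl w) * x v w := by
        simp only [CFLInstance.cost, CLRInstance.toScaledCFL, Finset.mul_sum]
        congr 1
        refine Finset.sum_congr rfl fun v _ => Finset.sum_congr rfl fun w _ => ?_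
        ring
      have h2 : 0 ≤ ∑ w ∈ F', I.openCost w := Finset.sum_nonneg fun w _ => I.openCost_nonneg w
      have h3 : 1 ≤ 2 / ε := by rw [le_div_iff₀ hε]; linarith
      have h4 : 2 / ε * (2 / I.vehicleCap) * s = 2 := by rw [hs_def]; field_simp
      rw [← hcost, h1, mul_add, ← mul_assoc]
      refine add_le_add (le_mul_of_one_le_left h2 h3) ?_
      refine le_trans (le_of_eq ?_) (mul_le_mul_of_nonneg_left hconn (by positivity))
      rw [← mul_assoc, h4]
    rw [CLRInstance.solutionCost, hsum]
    linarith
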